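/- Represent Markov kernels by column-stochastic $\mathbb{N}\times\mathbb{N}$ matrices with entries $A(y\mid x)$, and write $\|\phi-\psi\|_{TV}=\frac12\sum_{y}|\phi_y-\psi_y|$. A sequence $X_1,X_2,\ldots$ of $\mathbb{N}$-valued random variables is a Markov chain with initial distribution $p$ and kernel $A$ if $P(X_1=x_1,\ldots,X_n=x_n)=p(x_1)\prod_{i=1}^{n-1}A(x_{i+1}\mid x_i)$ for all $n\ge 1$ and $x\in\mathbb{N}^n$. A sequence $Y_1,Y_2,\ldots$ of $\mathbb{N}$-valued random variables is a hidden Markov chain with parameters $(p,A,B)$, where $B$ is a column-stochastic matrix of emission probabilities, if $P(Y_1=y_1,\ldots,Y_n=y_n)=\sum_{x\in\mathbb{N}^n}p(x_1)\prod_{i=1}^{n-1}A(x_{i+1}\mid x_i)\prod_{i=1}^{n}B(y_i\mid x_i)$ for all $n\ge 1$ and $y\in\mathbb{N}^n$. Let $\pi$ be a probability vector with $A\pi=\pi$. The kernel $A$ is $(G,\theta)$-geometrically ergodic, where $1\le G<\infty$ and $0\le\theta<1$, if $$\sup_{x\in\mathbb{N}}\|A^{s-1}(\cdot\mid x)-\pi\|_{TV}\le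 G\theta^{s-1}\qquad\text{for } s=1,2,\ldots$$ (with $\theta^0=1$; then $\pi$ is the unique stationary distribution of $A$). A Markov chain with kernel $A$, or a hidden Markov chain with parameters $(p,A,B)$, is called $(G,\theta)$-geometrically ergodic if $A$ is, and stationary if its (underlying) initial distribution is $p=\pi$; its stationary distribution is $\rho=\pi$ in the Markov case and $\rho=B\pi$ in the hidden Markov case. **Theorem.** Let $Y_1,Y_2,\ldots$ be a stationary $\mathbb{N}$-valued $(G,\theta)$-geometrically ergodic Markov or hidden Markov chain with stationary distribution $\rho$, and for $n\ge1$ let $\hat\rho^{(n)}_y=\frac1n\sum_{i=1}^n\mathbf 1_{\{Y_i=y\}}$, $y\in\mathbb{N}$. Then for all $n\ge 1$ and $\varepsilon>0$, $$P\left(\|\rho-\hat\rho^{(n)}\|_\infty>\sqrt{\frac{1+2G\theta}{n(1-\theta)}}+\varepsilon\right)\le\exp\left(-\frac{n(1-\theta)^2\varepsilon^2}{2G^2}\right),$$ where $\|v\|_\infty=\sup_{y\in\mathbb{N}}|v_y|$. -/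

import Mathlib

open MeasureTheory

/-!
Probability vectors on `ℕ` are `PMF ℕ`. A column-stochastic `ℕ × ℕ` matrix `A`, with entries
`A(y | x)`, is given by its columns, `A : ℕ → PMF ℕ`, so that `A(y | x) = A x y`, and the
matrix-vector product `A p` is `p.bind A`. A random sequence `Y₁, Y₂, …` is `Y : ℕ → Ω → ℕ`,
where `Y i` is the term `Y_{i+1}`.
-/

noncomputable section

/-- The probability `p(x₁) ∏ A(x_{i+1} | x_i)` of a path under the initial distribution `p`
and the transition kernel `A`. -/
def markovLaw (p : PMF ℕ) (A : ℕ → PMF ℕ) {n : ℕ} (x : Fin (n + 1) → ℕ) : ENNReal :=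
  p (x 0) * ∏ i : Fin n, A (x i.castSucc) (x i.succ)

/-- The probability of an observed path under the hidden Markov model `(p, A, B)`:
the sum over hidden paths `x` of `P(X = x) ∏ B(y_i | x_i)`. -/
def hiddenMarkovLaw (p : PMF ℕ) (A B : ℕ → PMF ℕ) {n : ℕ} (y : Fin (n + 1) → ℕ) : ENNReal :=
  ∑' x : Fin (n + 1) → ℕ, markovLaw p A x * ∏ i, B (x i) (y i)

/-- `Y` is a Markov chain with initial distribution `p` and transition kernel `A`. -/
def IsMarkovChain {Ω : Type*} [MeasurableSpace Ω] (μ : Measure Ω) (Y : ℕ → Ω → ℕ)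
    (p : PMF ℕ) (A : ℕ → PMF ℕ) : Prop :=
  (∀ i, Measurable (Y i)) ∧
    ∀ (n : ℕ) (y : Fin (n + 1) → ℕ), μ {ω | ∀ i : Fin (n + 1), Y i ω = y i} = markovLaw p A y

/-- `Y` is a hidden Markov chain with parameters `(p, A, B)`. -/
def IsHiddenMarkovChain {Ω : Type*} [MeasurableSpace Ω] (μ : Measure Ω) (Y : ℕ → Ω → ℕ)
    (p : PMF ℕ) (A B : ℕ → PMF ℕ) : Prop :=
  (∀ i, Measurable (Y i)) ∧
    ∀ (n : ℕ) (y : Fin (n + 1) → ℕ),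
      μ {ω | ∀ i : Fin (n + 1), Y i ω = y i} = hiddenMarkovLaw p A B y

/-- Total variation distance of two probability vectors (half the `ℓ¹` distance). -/
def tvDist (p q : PMF ℕ) : ℝ :=
  (1 / 2) * ∑' y, |(p y).toReal - (q y).toReal|

/-- Column `x` of the `k`-step kernel `A^k`: the law of the chain `k` steps after it is at `x`. -/
def stepLaw (A : ℕ → PMF ℕ) : ℕ → ℕ → PMF ℕ
  | 0, x => PMF.pure x
  | k + 1, x => (stepLaw A k x).bind A

/-- The inverse mixing time `τ_s = sup_x ‖L(X_s | X₁ = x) - π‖_TV`, for `s ≥ 1`. -/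
def invMixingTime (A : ℕ → PMF ℕ) (π : PMF ℕ) (s : ℕ) : ℝ :=
  ⨆ x : ℕ, tvDist (stepLaw A (s - 1) x) π

/-- `(G, θ)`-geometric ergodicity of the kernel `A` with stationary distribution `π`. The
uniqueness of the stationary distribution is not required here: it follows from the bound. -/
structure IsGeometricallyErgodic (A : ℕ → PMF ℕ) (π : PMF ℕ) (G θ : ℝ) : Prop where
  one_le_G : 1 ≤ G
  theta_nonneg : 0 ≤ θ
  theta_lt_one : θ < 1
  stationary : π.bind A = π
  mixing : ∀ s : ℕ, 1 ≤ s → invMixingTime A π s ≤ G * θ ^ (s - 1)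

/-- The empirical frequency of the value `y` among the first `n` terms of `Y`. -/
def empiricalFreq {Ω : Type*} (Y : ℕ → Ω → ℕ) (n : ℕ) (ω : Ω) (y : ℕ) : ℝ :=
  (1 / (n : ℝ)) * ∑ i ∈ Finset.range n, if Y i ω = y then 1 else 0

/-- The sup-norm distance `‖ρ - ρ̂⁽ⁿ⁾‖_∞`. -/
def supDeviation {Ω : Type*} (Y : ℕ → Ω → ℕ) (ρ : PMF ℕ) (n : ℕ) (ω : Ω) : ℝ :=
  ⨆ y : ℕ, |(ρ y).toReal - empiricalFreq Y n ω y|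

end

/-! A Markov chain is a hidden Markov chain with identity emission, so only the hidden case matters.
The deviation is a function of the first `n` letters that moves by at most `1/n` when one letter
changes, and the bound splits into concentration about the mean and an estimate of the mean.

Concentration (`integral_exp_pathLaw_le`): condition on the first hidden state and its emission, and
recurse. The conditional mean given this pair oscillates by at most `D`, because by
`integral_pathLaw_sub_le` changing the initial law shifts the mean of a Lipschitz function by at
most the Lipschitz constant times the sum of the total variation distances of the hidden marginals.
Geometric ergodicity makes this sum finite uniformly in the length, giving `D = 2G/(n(1-θ))`.
Hoeffding's lemma at each step and Chernoff's bound finish.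

Mean (`integral_freqDeviation_le`): the sup norm is at most the `ℓ²` norm, whose square depends on
the word only through a sum of `ρ`-weights and the number of coincidences. Mixing keeps the expected
number of coincidences close to its value for independent letters (`integral_coincidences_le`). -/

namespace PMF

/-! ### Integration against discrete laws and Hoeffding's lemma -/

theorem abs_integral_le {α : Type*} [MeasurableSpace α] (p : PMF α) {f : α → ℝ} {C : ℝ}
    (hf : ∀ a, |f a| ≤ C) : |∫ a, f a ∂p.toMeasure| ≤ C := by
  have := norm_integral_le_of_norm_le_const (μ := p.toMeasure) (f := f) (C := C)
    (Filter.Eventually.of_forall hf)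
  simpa using this

section Discrete

variable {α β : Type*} [MeasurableSpace α] [DiscreteMeasurableSpace α]

theorem integrable_of_abs_le (p : PMF α) {f : α → ℝ} {C : ℝ} (hf : ∀ a, |f a| ≤ C) :
    Integrable f p.toMeasure :=
  Integrable.of_bound (Measurable.of_discrete).aestronglyMeasurable C
    (Filter.Eventually.of_forall hf)

theorem integral_le_integral (p : PMF α) {f g : α → ℝ} {C D : ℝ} (hf : ∀ a, |f a| ≤ C)
    (hg : ∀ a, |g a| ≤ D) (h : ∀ a, f a ≤ g a) :
    ∫ a, f a ∂p.toMeasure ≤ ∫ a, g a ∂p.toMeasure :=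
  integral_mono (p.integrable_of_abs_le hf) (p.integrable_of_abs_le hg) h

theorem integral_le_const (p : PMF α) {f : α → ℝ} {C D : ℝ} (hf : ∀ a, |f a| ≤ C)
    (h : ∀ a, f a ≤ D) : ∫ a, f a ∂p.toMeasure ≤ D := by
  simpa using p.integral_le_integral (g := fun _ => D) hf (fun _ => le_rfl) h

theorem toMeasure_bind [Countable α] [MeasurableSpace β] (p : PMF α) (q : α → PMF β) :
    (p.bind q).toMeasure = p.toMeasure.bind fun a => (q a).toMeasure := by
  ext s hs
  rw [toMeasure_bind_apply _ _ _ hs, Measure.bind_apply hs Measurable.of_discrete.aemeasurable,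
    lintegral_countable']
  exact tsum_congr fun a => by
    rw [toMeasure_apply_singleton _ _ (measurableSet_singleton a), mul_comm]

theorem integral_bind [Countable α] [MeasurableSpace β] [DiscreteMeasurableSpace β]
    (p : PMF α) (q : α → PMF β) {f : β → ℝ} {C : ℝ} (hf : ∀ b, |f b| ≤ C) :
    ∫ b, f b ∂(p.bind q).toMeasure = ∫ a, ∫ b, f b ∂(q a).toMeasure ∂p.toMeasure := by
  have hi := (p.bind q).integrable_of_abs_le hf
  rw [toMeasure_bind] at hi ⊢
  let κ : ProbabilityTheory.Kernel Unit α := ProbabilityTheory.Kernel.const Unit p.toMeasure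
  let η : ProbabilityTheory.Kernel α β := ⟨fun a => (q a).toMeasure, Measurable.of_discrete⟩
  have h : (η.comp κ) () = p.toMeasure.bind fun a => (q a).toMeasure := by
    rw [ProbabilityTheory.Kernel.comp_apply]; rfl
  rw [← h] at hi ⊢
  exact ProbabilityTheory.Kernel.integral_comp hi

theorem integral_map [MeasurableSpace β] [DiscreteMeasurableSpace β]
    (p : PMF α) (g : α → β) (f : β → ℝ) :
    ∫ b, f b ∂(p.map g).toMeasure = ∫ a, f (g a) ∂p.toMeasure := by
  rw [← toMeasure_map p (f := g) Measurable.of_discrete,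
    MeasureTheory.integral_map Measurable.of_discrete.aemeasurable
    Measurable.of_discrete.aestronglyMeasurable]

/-- Hoeffding's lemma, with the range of `X` controlled only through its oscillation: the values lie
in an interval of length `D` starting at the infimum. -/
theorem integral_exp_mul_le (p : PMF α) {X : α → ℝ} {C D : ℝ} (hX : ∀ a, |X a| ≤ C)
    (hD : ∀ a b, X a ≤ X b + D) (t : ℝ) :
    ∫ a, Real.exp (t * X a) ∂p.toMeasure ≤
      Real.exp (t * ∫ a, X a ∂p.toMeasure + t ^ 2 * D ^ 2 / 8) := by
  have : Nonempty α := p.support_nonempty.to_type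
  have hbdd : BddBelow (Set.range X) :=
    ⟨-C, by rintro _ ⟨a, rfl⟩; exact (abs_le.mp (hX a)).1⟩
  have hmem : ∀ a, X a ∈ Set.Icc (⨅ b, X b) ((⨅ b, X b) + D) := fun a =>
    ⟨ciInf_le hbdd a, by
      have : X a - D ≤ ⨅ b, X b := le_ciInf fun b => by linarith [hD a b]
      linarith⟩
  have h := (ProbabilityTheory.hasSubgaussianMGF_of_mem_Icc (μ := p.toMeasure) (X := X)
    Measurable.of_discrete.aemeasurable (Filter.Eventually.of_forall hmem)).mgf_le t
  have hsq : (((‖(⨅ b, X b) + D - ⨅ b, X b‖₊ / 2) ^ 2 : NNReal) : ℝ) * t ^ 2 / 2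
      = t ^ 2 * D ^ 2 / 8 := by
    simp [div_pow]; ring
  rw [hsq, ProbabilityTheory.mgf] at h
  set m := ∫ a, X a ∂p.toMeasure
  have e : ∀ a, Real.exp (t * X a) = Real.exp (t * m) * Real.exp (t * (X a - m)) := fun a => by
    rw [← Real.exp_add]; ring_nf
  simp_rw [e]
  rw [integral_const_mul, Real.exp_add]
  gcongr

end Discrete

theorem summable_toReal {α : Type*} (p : PMF α) : Summable fun a => (p a).toReal :=
  ENNReal.summable_toReal (by simp [p.tsum_coe])

theorem tsum_toReal {α : Type*} (p : PMF α) : ∑' a, (p a).toReal = 1 := by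
  rw [← ENNReal.tsum_toReal_eq fun a => p.apply_ne_top a, p.tsum_coe, ENNReal.toReal_one]

end PMF

/-! ### Total variation distance -/

theorem summable_abs_sub_toReal (p q : PMF ℕ) :
    Summable fun y => |(p y).toReal - (q y).toReal| :=
  (p.summable_toReal.sub q.summable_toReal).abs

theorem tvDist_comm (p q : PMF ℕ) : tvDist p q = tvDist q p := by
  simp only [tvDist, abs_sub_comm]

theorem tvDist_triangle (p q r : PMF ℕ) : tvDist p r ≤ tvDist p q + tvDist q r := by
  rw [tvDist, tvDist, tvDist, ← mul_add,
    ← (summable_abs_sub_toReal p q).tsum_add (summable_abs_sub_toReal q r)]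
  refine mul_le_mul_of_nonneg_left ?_ (by norm_num)
  exact (summable_abs_sub_toReal p r).tsum_le_tsum (fun y => abs_sub_le _ _ _)
    ((summable_abs_sub_toReal p q).add (summable_abs_sub_toReal q r))

theorem tvDist_le_one (p q : PMF ℕ) : tvDist p q ≤ 1 := by
  have h : ∑' y, |(p y).toReal - (q y).toReal| ≤ ∑' y, ((p y).toReal + (q y).toReal) :=
    (summable_abs_sub_toReal p q).tsum_le_tsum (fun y => by
      have h1 : 0 ≤ (p y).toReal := ENNReal.toReal_nonneg
      have h2 : 0 ≤ (q y).toReal := ENNReal.toReal_nonneg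
      exact abs_le.mpr ⟨by linarith, by linarith⟩) (p.summable_toReal.add q.summable_toReal)
  rw [p.summable_toReal.tsum_add q.summable_toReal, p.tsum_toReal, q.tsum_toReal] at h
  rw [tvDist]; linarith

/-- Subtracting `c / 2` from `h` does not change the difference of the integrals and halves the
bound on `|h|`; this is where the factor one half in the total variation distance comes from. -/
theorem integral_sub_integral_le_tvDist (p q : PMF ℕ) {h : ℕ → ℝ} {c : ℝ}
    (h0 : ∀ x, 0 ≤ h x) (hc : ∀ x, h x ≤ c) :
    ∫ x, h x ∂p.toMeasure - ∫ x, h x ∂q.toMeasure ≤ c * tvDist p q := by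
  have hb : ∀ x, |h x| ≤ c := fun x => by rw [abs_of_nonneg (h0 x)]; exact hc x
  have hsum : ∀ r : PMF ℕ, Summable fun x => (r x).toReal * h x := fun r =>
    (r.summable_toReal.mul_right c).of_nonneg_of_le
      (fun x => mul_nonneg ENNReal.toReal_nonneg (h0 x))
      (fun x => mul_le_mul_of_nonneg_left (hc x) ENNReal.toReal_nonneg)
  have hs : ∀ r : PMF ℕ, HasSum (fun x => (r x).toReal * (h x - c / 2))
      (∫ x, h x ∂r.toMeasure - c / 2) := fun r => by
    have h1 := (hsum r).hasSum.sub (r.summable_toReal.hasSum.mul_right (c / 2))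
    rw [r.tsum_toReal, one_mul] at h1
    rw [r.integral_eq_tsum h (r.integrable_of_abs_le hb)]
    simpa [mul_sub] using h1
  have hd := (hs p).sub (hs q)
  have ht := (summable_abs_sub_toReal p q).hasSum.mul_right (c / 2)
  have := hasSum_le (fun x => ?_) hd ht
  · rw [tvDist]; linarith
  · rw [← sub_mul]
    refine (le_abs_self _).trans ?_
    rw [abs_mul]
    refine mul_le_mul_of_nonneg_left ?_ (abs_nonneg _)
    exact abs_le.mpr ⟨by linarith [h0 x], by linarith [hc x]⟩

/-! ### Recursive path laws of a hidden Markov chain -/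

noncomputable section

/-- The joint law of a hidden state with law `p` and of the value that it emits. -/
def emissionLaw (p : PMF ℕ) (B : ℕ → PMF ℕ) : PMF (ℕ × ℕ) :=
  p.bind fun x => (B x).map (Prod.mk x)

/-- The law of the first `m` terms of the hidden Markov chain with parameters `(p, A, B)`. -/
def pathLaw (A B : ℕ → PMF ℕ) : (m : ℕ) → PMF ℕ → PMF (Fin m → ℕ)
  | 0, _ => PMF.pure Fin.elim0
  | m + 1, p => (emissionLaw p B).bind fun z =>
      (pathLaw A B m (A z.1)).map (Fin.cons (α := fun _ => ℕ) z.2)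

/-- Changing one coordinate changes the value of `f` by at most `c`. -/
def HammingLipschitz {m : ℕ} (c : ℝ) (f : (Fin m → ℕ) → ℝ) : Prop :=
  ∀ i w w', (∀ j, j ≠ i → w j = w' j) → f w ≤ f w' + c

/-- The law after `s` steps of a chain with initial distribution `p`. -/
def iterLaw (A : ℕ → PMF ℕ) (s : ℕ) (p : PMF ℕ) : PMF ℕ :=
  (fun q : PMF ℕ => q.bind A)^[s] p

end

section HiddenMarkov

variable {A B : ℕ → PMF ℕ}

theorem iterLaw_zero (p : PMF ℕ) : iterLaw A 0 p = p := rfl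

theorem iterLaw_succ (s : ℕ) (p : PMF ℕ) : iterLaw A (s + 1) p = iterLaw A s (p.bind A) :=
  Function.iterate_succ_apply _ _ _

/-- `stepLaw` adds a transition at the end, whereas `iterLaw` peels one off at the start, as the
recursion for `pathLaw` does; this reconciles the two. -/
theorem iterLaw_stepLaw (s k x : ℕ) : iterLaw A s (stepLaw A k x) = stepLaw A (k + s) x := by
  induction s generalizing k with
  | zero => rfl
  | succ s ih =>
    rw [iterLaw_succ]
    exact (ih (k + 1)).trans (by rw [Nat.add_right_comm, Nat.add_assoc])

theorem iterLaw_apply (s x : ℕ) : iterLaw A s (A x) = stepLaw A (s + 1) x := by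
  have h : stepLaw A 1 x = A x := by simp [stepLaw, PMF.pure_bind]
  rw [← h, iterLaw_stepLaw, Nat.add_comm]

theorem iterLaw_stationary {π : PMF ℕ} (h : π.bind A = π) (s : ℕ) : iterLaw A s π = π := by
  induction s with
  | zero => rfl
  | succ s ih => rw [iterLaw_succ, h, ih]

theorem integral_emissionLaw (p : PMF ℕ) {φ : ℕ × ℕ → ℝ} {C : ℝ} (hφ : ∀ z, |φ z| ≤ C) :
    ∫ z, φ z ∂(emissionLaw p B).toMeasure
      = ∫ x, ∫ y, φ (x, y) ∂(B x).toMeasure ∂p.toMeasure := by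
  rw [emissionLaw, PMF.integral_bind _ _ hφ]
  simp_rw [PMF.integral_map]

theorem integral_emissionLaw_fst (p : PMF ℕ) {φ : ℕ → ℝ} {C : ℝ} (hφ : ∀ x, |φ x| ≤ C) :
    ∫ z, φ z.1 ∂(emissionLaw p B).toMeasure = ∫ x, φ x ∂p.toMeasure := by
  rw [integral_emissionLaw p fun z => hφ z.1]
  simp

theorem integral_pathLaw_succ (p : PMF ℕ) {m : ℕ} {f : (Fin (m + 1) → ℕ) → ℝ} {C : ℝ}
    (hf : ∀ w, |f w| ≤ C) :
    ∫ w, f w ∂(pathLaw A B (m + 1) p).toMeasure =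
      ∫ z, ∫ w, f (Fin.cons z.2 w) ∂(pathLaw A B m (A z.1)).toMeasure
        ∂(emissionLaw p B).toMeasure := by
  rw [pathLaw, PMF.integral_bind _ _ hf]
  simp_rw [PMF.integral_map]

/-- The path law is affine in the initial distribution, so averaging over the next hidden state
amounts to starting from the averaged law. -/
theorem pathLaw_bind (m : ℕ) (p : PMF ℕ) (q : ℕ → PMF ℕ) :
    pathLaw A B m (p.bind q) = p.bind fun x => pathLaw A B m (q x) := by
  cases m with
  | zero => simp [pathLaw, PMF.bind_const]
  | succ m => simp [pathLaw, emissionLaw, PMF.bind_bind]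

theorem integral_pathLaw_tail (p : PMF ℕ) {m : ℕ} {g : (Fin m → ℕ) → ℝ} {C : ℝ}
    (hg : ∀ w, |g w| ≤ C) :
    ∫ z, ∫ w, g w ∂(pathLaw A B m (A z.1)).toMeasure ∂(emissionLaw p B).toMeasure =
      ∫ w, g w ∂(pathLaw A B m (p.bind A)).toMeasure := by
  rw [integral_emissionLaw_fst p (φ := fun x => ∫ w, g w ∂(pathLaw A B m (A x)).toMeasure)
    fun x => PMF.abs_integral_le _ hg, pathLaw_bind, PMF.integral_bind _ _ hg]

theorem HammingLipschitz.cons {m : ℕ} {c : ℝ} {f : (Fin (m + 1) → ℕ) → ℝ}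
    (hf : HammingLipschitz c f) (y : ℕ) :
    HammingLipschitz c fun w : Fin m → ℕ => f (Fin.cons y w) := by
  intro i w w' h
  refine hf i.succ _ _ fun j hj => ?_
  cases j using Fin.cases with
  | zero => rfl
  | succ j => simpa using h j fun e => hj (e ▸ rfl)

theorem HammingLipschitz.head_le {m : ℕ} {c : ℝ} {f : (Fin (m + 1) → ℕ) → ℝ}
    (hf : HammingLipschitz c f) (y y' : ℕ) (w : Fin m → ℕ) :
    f (Fin.cons y w) ≤ f (Fin.cons y' w) + c := by
  refine hf 0 _ _ fun j hj => ?_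
  cases j using Fin.cases with
  | zero => exact absurd rfl hj
  | succ j => rfl

/-! ### Concentration for Lipschitz functions -/

/-- A Lipschitz function integrates almost equally against path laws whose marginals are close. -/
theorem integral_pathLaw_sub_le {m : ℕ} {c C : ℝ} {f : (Fin m → ℕ) → ℝ}
    (hf : HammingLipschitz c f) (hC : ∀ w, |f w| ≤ C) (p q : PMF ℕ) :
    ∫ w, f w ∂(pathLaw A B m p).toMeasure - ∫ w, f w ∂(pathLaw A B m q).toMeasure ≤
      c * ∑ s ∈ Finset.range m, tvDist (iterLaw A s p) (iterLaw A s q) := by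
  induction m generalizing p q with
  | zero => simp [pathLaw]
  | succ m ih =>
    -- Minimising over the first letter leaves a function of the tail that is still `c`-Lipschitz
    -- and lies within `c` below `f`. The remainder `f - g` costs only the distance of the initial
    -- laws, and `g` goes to the induction hypothesis one step later.
    set g : (Fin m → ℕ) → ℝ := fun w => ⨅ u : ℕ, f (Fin.cons u w) with hg
    have hbdd : ∀ w : Fin m → ℕ, BddBelow (Set.range fun u : ℕ => f (Fin.cons u w)) := fun w =>
      ⟨-C, by rintro _ ⟨a, rfl⟩; exact (abs_le.mp (hC _)).1⟩
    have hgle : ∀ w u, g w ≤ f (Fin.cons u w) := fun w u => ciInf_le (hbdd w) u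
    have hleg : ∀ w u, f (Fin.cons u w) ≤ g w + c := fun w u => by
      have : f (Fin.cons u w) - c ≤ g w := le_ciInf fun u' => by linarith [hf.head_le u u' w]
      linarith
    have hgC : ∀ w, |g w| ≤ C := fun w => abs_le.mpr
      ⟨le_ciInf fun u => (abs_le.mp (hC _)).1, (hgle w 0).trans (abs_le.mp (hC _)).2⟩
    have hgL : HammingLipschitz c g := fun i w w' h => by
      have : g w - c ≤ g w' := le_ciInf fun u => by
        linarith [hf.cons u i w w' h, hgle w u]
      linarith
    set h : ℕ × ℕ → ℝ := fun z =>
      ∫ w, (f (Fin.cons z.2 w) - g w) ∂(pathLaw A B m (A z.1)).toMeasure with hh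
    have hd0 : ∀ (y : ℕ) w, 0 ≤ f (Fin.cons y w) - g w := fun y w => by linarith [hgle w y]
    have hdc : ∀ (y : ℕ) w, f (Fin.cons y w) - g w ≤ c := fun y w => by linarith [hleg w y]
    have hdabs : ∀ (y : ℕ) w, |f (Fin.cons y w) - g w| ≤ c := fun y w => by
      rw [abs_of_nonneg (hd0 y w)]; exact hdc y w
    have h0 : ∀ z, 0 ≤ h z := fun z => integral_nonneg fun w => hd0 _ w
    have hc : ∀ z, h z ≤ c := fun z => PMF.integral_le_const _ (hdabs z.2) (hdc z.2)
    have habs : ∀ z, |h z| ≤ c := fun z => PMF.abs_integral_le _ (hdabs z.2)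
    have key : ∀ r : PMF ℕ, ∫ w, f w ∂(pathLaw A B (m + 1) r).toMeasure =
        ∫ x, ∫ y, h (x, y) ∂(B x).toMeasure ∂r.toMeasure
          + ∫ w, g w ∂(pathLaw A B m (r.bind A)).toMeasure := fun r => by
      rw [integral_pathLaw_succ r hC, ← integral_pathLaw_tail (B := B) r hgC,
        ← integral_emissionLaw r habs, ← integral_add (PMF.integrable_of_abs_le _ habs)
          (PMF.integrable_of_abs_le _ fun z => PMF.abs_integral_le _ hgC)]
      refine integral_congr_ae (Filter.Eventually.of_forall fun z => ?_)
      simp only [hh]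
      rw [integral_sub (PMF.integrable_of_abs_le _ fun w => hC _)
        (PMF.integrable_of_abs_le _ hgC), sub_add_cancel]
    rw [key, key, Finset.sum_range_succ', mul_add]
    have h1 := ih hgL hgC (p.bind A) (q.bind A)
    have h2 := integral_sub_integral_le_tvDist p q
      (h := fun x => ∫ y, h (x, y) ∂(B x).toMeasure) (c := c)
      (fun x => integral_nonneg fun y => h0 _)
      (fun x => PMF.integral_le_const _ (fun y => habs (x, y)) fun y => hc _)
    simp only [iterLaw_succ, iterLaw_zero]
    linarith

/-- A Hoeffding-Azuma bound for the moment generating function along a hidden Markov chain. -/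
theorem integral_exp_pathLaw_le {m : ℕ} {c C D : ℝ} {f : (Fin m → ℕ) → ℝ}
    (hf : HammingLipschitz c f) (hC : ∀ w, |f w| ≤ C)
    (hD : ∀ (k x x' : ℕ), c * (1 + ∑ s ∈ Finset.range k,
      tvDist (iterLaw A s (A x)) (iterLaw A s (A x'))) ≤ D) (p : PMF ℕ) (t : ℝ) :
    ∫ w, Real.exp (t * f w) ∂(pathLaw A B m p).toMeasure ≤
      Real.exp (t * ∫ w, f w ∂(pathLaw A B m p).toMeasure + m * (t ^ 2 * D ^ 2 / 8)) := by
  induction m generalizing p with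
  | zero => simp [pathLaw, PMF.toMeasure_pure]
  | succ m ih =>
    set h : ℕ × ℕ → ℝ := fun z =>
      ∫ w, f (Fin.cons z.2 w) ∂(pathLaw A B m (A z.1)).toMeasure with hh
    have habs : ∀ z, |h z| ≤ C := fun z => PMF.abs_integral_le _ fun w => hC _
    have hexp : ∀ {a : ℝ}, |a| ≤ C → |Real.exp (t * a)| ≤ Real.exp (|t| * C) := fun {a} ha => by
      rw [Real.abs_exp]
      refine Real.exp_le_exp.mpr ((le_abs_self _).trans ?_)
      rw [abs_mul]
      exact mul_le_mul_of_nonneg_left ha (abs_nonneg _)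
    -- Swapping the emitted letter costs `c`; swapping the hidden state then changes the law of the
    -- tail, which costs `c` times the sum of the distances.
    have hosc : ∀ z z', h z ≤ h z' + D := fun z z' => by
      have h1 : h z ≤ ∫ w, (f (Fin.cons z'.2 w) + c) ∂(pathLaw A B m (A z.1)).toMeasure :=
        integral_mono (PMF.integrable_of_abs_le _ fun w => hC _)
          ((PMF.integrable_of_abs_le _ fun w => hC _).add (integrable_const c))
          fun w => hf.head_le _ _ w
      rw [integral_add (PMF.integrable_of_abs_le _ fun w => hC _) (integrable_const c)] at h1
      have h2 := integral_pathLaw_sub_le (A := A) (B := B) (hf.cons z'.2)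
        (fun w => hC (Fin.cons z'.2 w)) (A z.1) (A z'.1)
      have h3 := hD m z.1 z'.1
      simp only [integral_const, probReal_univ, one_smul] at h1
      simp only [hh] at h1 ⊢
      linarith
    rw [integral_pathLaw_succ p fun w => hexp (hC w), integral_pathLaw_succ p hC]
    have step : ∫ z, ∫ w, Real.exp (t * f (Fin.cons z.2 w)) ∂(pathLaw A B m (A z.1)).toMeasure
        ∂(emissionLaw p B).toMeasure ≤
        ∫ z, Real.exp (t * h z) * Real.exp (m * (t ^ 2 * D ^ 2 / 8))
          ∂(emissionLaw p B).toMeasure := by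
      refine integral_mono
        (PMF.integrable_of_abs_le _ fun z => PMF.abs_integral_le _ fun w => hexp (hC _))
        ((PMF.integrable_of_abs_le _ fun z => hexp (habs z)).mul_const _) fun z => ?_
      dsimp only
      rw [← Real.exp_add]
      exact ih (hf.cons z.2) (fun w => hC _) (A z.1)
    rw [integral_mul_const] at step
    -- Hoeffding's lemma for the conditional mean `h` contributes one more factor `exp (t ^ 2 * D ^
    -- 2 / 8)`.
    refine step.trans ((mul_le_mul_of_nonneg_right
      (PMF.integral_exp_mul_le _ habs hosc t) (Real.exp_nonneg _)).trans_eq ?_)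
    rw [← Real.exp_add]
    congr 1
    simp only [hh]
    push_cast
    ring

/-! ### Identification of the path law with the law of the chain -/

theorem PMF.toReal_le_one {α : Type*} (p : PMF α) (a : α) : (p a).toReal ≤ 1 :=
  ENNReal.toReal_le_of_le_ofReal zero_le_one (by simpa using p.coe_le_one a)

theorem PMF.map_cons_apply {m : ℕ} (q : PMF (Fin m → ℕ)) (a : ℕ) (y : Fin (m + 1) → ℕ) :
    q.map (Fin.cons (α := fun _ => ℕ) a) y = if y 0 = a then q (Fin.tail y) else 0 := by
  rw [PMF.map_apply]
  split_ifs with h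
  · subst h
    rw [tsum_eq_single (Fin.tail y)]
    · rw [if_pos (Fin.cons_self_tail y).symm]
    · intro w hw
      refine if_neg fun e => hw ?_
      rw [e, Fin.tail_cons]
  · refine ENNReal.tsum_eq_zero.mpr fun w => if_neg fun e => h ?_
    rw [e, Fin.cons_zero]

theorem pathLaw_succ_apply (m : ℕ) (p : PMF ℕ) (y : Fin (m + 1) → ℕ) :
    pathLaw A B (m + 1) p y =
      ∑' x, p x * (B x (y 0) * pathLaw A B m (A x) (Fin.tail y)) := by
  have h : pathLaw A B (m + 1) p = p.bind fun x => (B x).bind fun a =>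
      (pathLaw A B m (A x)).map (Fin.cons (α := fun _ => ℕ) a) := by
    simp [pathLaw, emissionLaw, PMF.bind_bind, PMF.bind_map, Function.comp_def]
  rw [h, PMF.bind_apply]
  refine tsum_congr fun x => ?_
  rw [PMF.bind_apply, tsum_eq_single (y 0), PMF.map_cons_apply, if_pos rfl]
  intro a ha
  rw [PMF.map_cons_apply, if_neg ha.symm, mul_zero]

theorem markovLaw_cons (p : PMF ℕ) {n : ℕ} (a : ℕ) (x : Fin (n + 1) → ℕ) :
    markovLaw p A (Fin.cons (α := fun _ => ℕ) a x) = p a * markovLaw (A a) A x := by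
  simp [markovLaw, Fin.prod_univ_succ]

/-- Splitting off the first hidden state gives the same recursion as `pathLaw_succ_apply`, so the
two laws agree by induction. -/
theorem hiddenMarkovLaw_succ (p : PMF ℕ) {n : ℕ} (y : Fin (n + 2) → ℕ) :
    hiddenMarkovLaw p A B y =
      ∑' x, p x * (B x (y 0) * hiddenMarkovLaw (A x) A B (Fin.tail y)) := by
  rw [hiddenMarkovLaw, ← (Fin.consEquiv fun _ => ℕ).tsum_eq, ENNReal.tsum_prod']
  refine tsum_congr fun a => ?_
  rw [hiddenMarkovLaw, ← ENNReal.tsum_mul_left, ← ENNReal.tsum_mul_left]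
  refine tsum_congr fun x => ?_
  simp only [Fin.consEquiv, Equiv.coe_fn_mk]
  rw [markovLaw_cons, Fin.prod_univ_succ]
  simp only [Fin.cons_zero, Fin.cons_succ, Fin.tail]
  ring

theorem pathLaw_apply (n : ℕ) (p : PMF ℕ) (y : Fin (n + 1) → ℕ) :
    pathLaw A B (n + 1) p y = hiddenMarkovLaw p A B y := by
  induction n generalizing p with
  | zero =>
    rw [pathLaw_succ_apply, hiddenMarkovLaw, ← (Equiv.funUnique (Fin 1) ℕ).symm.tsum_eq]
    refine tsum_congr fun x => ?_
    have : Fin.tail y = Fin.elim0 := Subsingleton.elim _ _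
    simp [pathLaw, markovLaw, this]
  | succ n ih =>
    rw [pathLaw_succ_apply, hiddenMarkovLaw_succ]
    exact tsum_congr fun x => by rw [ih]

/-- With identity emission, only the hidden path equal to the observed one contributes. -/
theorem hiddenMarkovLaw_pure (p : PMF ℕ) {n : ℕ} (y : Fin (n + 1) → ℕ) :
    hiddenMarkovLaw p A PMF.pure y = markovLaw p A y := by
  rw [hiddenMarkovLaw, tsum_eq_single y]
  · simp
  · intro x hx
    obtain ⟨i, hi⟩ := Function.ne_iff.mp hx
    rw [Finset.prod_eq_zero (Finset.mem_univ i), mul_zero]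
    simp [PMF.pure_apply, hi.symm]

theorem IsMarkovChain.isHiddenMarkovChain {Ω : Type*} [MeasurableSpace Ω] {μ : Measure Ω}
    {Y : ℕ → Ω → ℕ} {p : PMF ℕ} (h : IsMarkovChain μ Y p A) :
    IsHiddenMarkovChain μ Y p A PMF.pure :=
  ⟨h.1, fun n y => by rw [h.2, hiddenMarkovLaw_pure]⟩

theorem IsHiddenMarkovChain.map_eq {Ω : Type*} [MeasurableSpace Ω] {μ : Measure Ω}
    {Y : ℕ → Ω → ℕ} {p : PMF ℕ} (h : IsHiddenMarkovChain μ Y p A B) (n : ℕ) :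
    μ.map (fun ω (i : Fin (n + 1)) => Y i ω) = (pathLaw A B (n + 1) p).toMeasure := by
  refine Measure.ext_of_singleton fun y => ?_
  have hm : Measurable fun ω (i : Fin (n + 1)) => Y i ω := measurable_pi_lambda _ fun i => h.1 i
  rw [Measure.map_apply hm (measurableSet_singleton y),
    PMF.toMeasure_apply_singleton _ _ (measurableSet_singleton y), pathLaw_apply, ← h.2]
  congr 1
  ext ω
  simp [funext_iff]

/-! ### Consequences of geometric ergodicity -/

theorem IsGeometricallyErgodic.tvDist_stepLaw_le {π : PMF ℕ} {G θ : ℝ}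
    (h : IsGeometricallyErgodic A π G θ) (k x : ℕ) :
    tvDist (stepLaw A k x) π ≤ G * θ ^ k := by
  have h1 := h.mixing (k + 1) (Nat.le_add_left 1 k)
  rw [invMixingTime, Nat.add_sub_cancel] at h1
  -- A real supremum dominates its terms only when the family is bounded, here by `tvDist_le_one`.
  exact (le_ciSup (f := fun x => tvDist (stepLaw A k x) π)
    ⟨1, by rintro _ ⟨y, rfl⟩; exact tvDist_le_one _ _⟩ x).trans h1

theorem sum_range_pow_succ_le {θ : ℝ} (h0 : 0 ≤ θ) (h1 : θ < 1) (m : ℕ) :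
    ∑ s ∈ Finset.range m, θ ^ (s + 1) ≤ θ / (1 - θ) := by
  simp_rw [pow_succ']
  rw [← Finset.mul_sum, div_eq_mul_inv]
  refine mul_le_mul_of_nonneg_left ?_ h0
  rw [← tsum_geometric_of_lt_one h0 h1]
  exact (summable_geometric_of_lt_one h0 h1).sum_le_tsum _ fun i _ => pow_nonneg h0 i

theorem IsGeometricallyErgodic.sum_tvDist_le {π : PMF ℕ} {G θ : ℝ}
    (h : IsGeometricallyErgodic A π G θ) (m x : ℕ) :
    ∑ s ∈ Finset.range m, tvDist (iterLaw A s (A x)) π ≤ G * θ / (1 - θ) := by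
  have hG : 0 ≤ G := zero_le_one.trans h.one_le_G
  calc _ ≤ ∑ s ∈ Finset.range m, G * θ ^ (s + 1) := Finset.sum_le_sum fun s _ => by
        rw [iterLaw_apply]; exact h.tvDist_stepLaw_le _ _
    _ ≤ _ := by
      rw [← Finset.mul_sum, mul_div_assoc]
      exact mul_le_mul_of_nonneg_left (sum_range_pow_succ_le h.theta_nonneg h.theta_lt_one m) hG

theorem integral_pathLaw_sum (p : PMF ℕ) (m : ℕ) {φ : ℕ → ℝ} {C : ℝ} (hφ : ∀ y, |φ y| ≤ C) :
    ∫ w, ∑ i, φ (w i) ∂(pathLaw A B m p).toMeasure =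
      ∑ s ∈ Finset.range m, ∫ x, ∫ y, φ y ∂(B x).toMeasure ∂(iterLaw A s p).toMeasure := by
  induction m generalizing p with
  | zero => simp
  | succ m ih =>
    have hsum : ∀ (k : ℕ) (w : Fin k → ℕ), |∑ i, φ (w i)| ≤ k * C := fun k w =>
      (Finset.abs_sum_le_sum_abs _ _).trans
        ((Finset.sum_le_sum fun i _ => hφ (w i)).trans_eq (by simp))
    rw [integral_pathLaw_succ p (hsum _), Finset.sum_range_succ']
    simp_rw [Fin.sum_univ_succ, Fin.cons_zero, Fin.cons_succ]
    have e : ∀ z : ℕ × ℕ, ∫ w : Fin m → ℕ, (φ z.2 + ∑ i, φ (w i))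
        ∂(pathLaw A B m (A z.1)).toMeasure =
        φ z.2 + ∫ w, ∑ i, φ (w i) ∂(pathLaw A B m (A z.1)).toMeasure := fun z => by
      rw [integral_add (integrable_const _) (PMF.integrable_of_abs_le _ (hsum m))]
      simp
    simp_rw [e]
    have i1 : Integrable (fun z : ℕ × ℕ => φ z.2) (emissionLaw p B).toMeasure :=
      PMF.integrable_of_abs_le _ fun z => hφ z.2
    have i2 : Integrable (fun z : ℕ × ℕ => ∫ w : Fin m → ℕ, ∑ i, φ (w i)
        ∂(pathLaw A B m (A z.1)).toMeasure) (emissionLaw p B).toMeasure :=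
      PMF.integrable_of_abs_le _ fun z => PMF.abs_integral_le _ (hsum m)
    rw [integral_add i1 i2,
      integral_pathLaw_tail p (hsum m), ih, integral_emissionLaw p fun z => hφ z.2, add_comm]
    simp only [iterLaw_succ, iterLaw_zero]

theorem integral_pathLaw_sum_stationary {π : PMF ℕ} (h : π.bind A = π) (m : ℕ) {φ : ℕ → ℝ} {C : ℝ}
    (hφ : ∀ y, |φ y| ≤ C) :
    ∫ w, ∑ i, φ (w i) ∂(pathLaw A B m π).toMeasure =
      m * ∫ y, φ y ∂(π.bind B).toMeasure := by
  rw [integral_pathLaw_sum π m hφ, PMF.integral_bind _ _ hφ]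
  simp [iterLaw_stationary h]

theorem PMF.integral_ite_eq (p : PMF ℕ) (y : ℕ) :
    ∫ a, (if a = y then (1 : ℝ) else 0) ∂p.toMeasure = (p y).toReal := by
  rw [p.integral_eq_tsum _ (p.integrable_of_abs_le (C := 1) fun a => by split_ifs <;> simp),
    tsum_eq_single y] <;> simp +contextual

theorem IsGeometricallyErgodic.integral_count_le {π : PMF ℕ} {G θ : ℝ}
    (h : IsGeometricallyErgodic A π G θ) (m x y : ℕ) :
    ∫ w : Fin m → ℕ, ∑ i, (if w i = y then (1 : ℝ) else 0) ∂(pathLaw A B m (A x)).toMeasure ≤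
      G * θ / (1 - θ) + m * (π.bind B y).toReal := by
  have hb : ∀ a, |if a = y then (1 : ℝ) else 0| ≤ 1 := fun a => by split_ifs <;> simp
  rw [integral_pathLaw_sum _ m hb]
  have key : ∀ s ∈ Finset.range m, ∫ x, ∫ a, (if a = y then (1 : ℝ) else 0) ∂(B x).toMeasure
      ∂(iterLaw A s (A x)).toMeasure ≤ tvDist (iterLaw A s (A x)) π + (π.bind B y).toReal := by
    intro s _
    -- The probability of emitting `y` is a `[0, 1]`-valued function of the hidden state, so mixing
    -- of the hidden chain suffices, with `c = 1`.
    have h1 := integral_sub_integral_le_tvDist (iterLaw A s (A x)) π (c := 1)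
      (h := fun x => ∫ a, (if a = y then (1 : ℝ) else 0) ∂(B x).toMeasure)
      (fun x => integral_nonneg fun a => by dsimp only; split_ifs <;> simp)
      (fun x => (abs_le.mp (PMF.abs_integral_le _ hb)).2)
    rw [← PMF.integral_bind π B hb, PMF.integral_ite_eq (π.bind B)] at h1
    rw [one_mul] at h1
    linarith
  refine (Finset.sum_le_sum key).trans ?_
  rw [Finset.sum_add_distrib]
  have := h.sum_tvDist_le m x
  simp only [Finset.sum_const, Finset.card_range, nsmul_eq_mul]
  linarith

/-! ### Expected number of coincidences -/

/-- The number of pairs of positions at which the word `w` has equal letters. -/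
noncomputable def coincidences {m : ℕ} (w : Fin m → ℕ) : ℝ :=
  ∑ i, ∑ j, if w i = w j then 1 else 0

theorem coincidences_cons {m : ℕ} (y : ℕ) (w : Fin m → ℕ) :
    coincidences (Fin.cons y w : Fin (m + 1) → ℕ) =
      1 + 2 * ∑ i, (if w i = y then (1 : ℝ) else 0) + coincidences w := by
  simp only [coincidences, Fin.sum_univ_succ, Fin.cons_zero, Fin.cons_succ,
    Finset.sum_add_distrib, if_true]
  simp only [eq_comm (a := y)]
  ring

theorem abs_sum_ite_le {m : ℕ} (y : ℕ) (w : Fin m → ℕ) :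
    |∑ i, (if w i = y then (1 : ℝ) else 0)| ≤ m := by
  rw [abs_of_nonneg (by positivity)]
  refine (Finset.sum_le_sum (g := fun _ => 1) fun i _ => ?_).trans (by simp)
  split_ifs <;> simp

theorem abs_coincidences_le {m : ℕ} (w : Fin m → ℕ) : |coincidences w| ≤ m * m :=
  (Finset.abs_sum_le_sum_abs _ _).trans ((Finset.sum_le_sum fun i _ => by
    simp only [eq_comm (a := w i)]; exact abs_sum_ite_le (w i) w).trans_eq (by simp))

/-- A new first letter adds its coincidence with itself and twice its matches in the tail. Given the
first hidden state, the expected matches exceed `m * ρ y` by at most `R`, whatever that state is; by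
stationarity the tail again starts from `π`, so the induction closes. -/
theorem IsGeometricallyErgodic.integral_coincidences_le {π : PMF ℕ} {G θ : ℝ}
    (h : IsGeometricallyErgodic A π G θ) (m : ℕ) :
    ∫ w, coincidences w ∂(pathLaw A B m π).toMeasure ≤
      m * (1 + 2 * (G * θ / (1 - θ))) +
        m * (m - 1) * ∫ y, (π.bind B y).toReal ∂(π.bind B).toMeasure := by
  induction m with
  | zero => simp [coincidences]
  | succ m ih =>
    set R := G * θ / (1 - θ)
    set ρ := π.bind B with hρdef
    set J : ℕ × ℕ → ℝ := fun z => ∫ w, coincidences w ∂(pathLaw A B m (A z.1)).toMeasure with hJ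
    have hρ : ∀ y, |(ρ y).toReal| ≤ 1 := fun y => by
      rw [abs_of_nonneg ENNReal.toReal_nonneg]
      exact ρ.toReal_le_one y
    have hJb : ∀ z, |J z| ≤ m * m := fun z => PMF.abs_integral_le _ abs_coincidences_le
    have hint : ∀ z : ℕ × ℕ, ∫ w : Fin m → ℕ, coincidences (Fin.cons z.2 w : Fin (m + 1) → ℕ)
        ∂(pathLaw A B m (A z.1)).toMeasure ≤ (1 + 2 * R + 2 * m * (ρ z.2).toReal) + J z := by
      intro z
      have i0 : Integrable (fun _ => (1 : ℝ)) (pathLaw A B m (A z.1)).toMeasure :=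
        integrable_const _
      have i1 := ((pathLaw A B m (A z.1)).integrable_of_abs_le (abs_sum_ite_le z.2)).const_mul 2
      have i2 := (pathLaw A B m (A z.1)).integrable_of_abs_le abs_coincidences_le
      simp_rw [coincidences_cons]
      rw [integral_add (f := fun w : Fin m → ℕ => 1 + 2 * ∑ i, (if w i = z.2 then (1 : ℝ) else 0))
        (i0.add i1) i2, integral_add i0 i1, integral_const_mul]
      have := h.integral_count_le (B := B) m z.1 z.2
      simp only [integral_const, probReal_univ, one_smul]
      linarith
    have i0 : Integrable (fun _ : ℕ × ℕ => 1 + 2 * R) (emissionLaw π B).toMeasure :=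
      integrable_const _
    have i1 : Integrable (fun z : ℕ × ℕ => 2 * m * (ρ z.2).toReal) (emissionLaw π B).toMeasure :=
      ((emissionLaw π B).integrable_of_abs_le fun z => hρ z.2).const_mul _
    have i2 : Integrable J (emissionLaw π B).toMeasure := PMF.integrable_of_abs_le _ hJb
    have i3 : Integrable (fun z : ℕ × ℕ => ∫ w : Fin m → ℕ,
        coincidences (Fin.cons z.2 w : Fin (m + 1) → ℕ) ∂(pathLaw A B m (A z.1)).toMeasure)
        (emissionLaw π B).toMeasure :=
      PMF.integrable_of_abs_le _ fun z => PMF.abs_integral_le _ fun w => abs_coincidences_le _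
    rw [integral_pathLaw_succ π abs_coincidences_le]
    refine (integral_mono i3 ((i0.add i1).add i2) hint).trans ?_
    have e : ∫ z : ℕ × ℕ, (1 + 2 * R + 2 * m * (ρ z.2).toReal + J z) ∂(emissionLaw π B).toMeasure =
        1 + 2 * R + 2 * m * ∫ y, (ρ y).toReal ∂ρ.toMeasure
          + ∫ w, coincidences w ∂(pathLaw A B m π).toMeasure := by
      rw [integral_add (f := fun z : ℕ × ℕ => 1 + 2 * R + 2 * m * (ρ z.2).toReal) (i0.add i1) i2,
        integral_add i0 i1, integral_const_mul, integral_emissionLaw π fun z => hρ z.2,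
        ← PMF.integral_bind π B hρ, hJ, integral_pathLaw_tail π abs_coincidences_le, h.stationary,
        ← hρdef]
      simp
    refine e.trans_le ?_
    push_cast
    linarith

/-! ### The sup-norm deviation as a function of the word -/

/-- The sup-norm distance from `ρ` to the empirical distribution of the word `w`. -/
noncomputable def freqDeviation (ρ : PMF ℕ) {n : ℕ} (w : Fin n → ℕ) : ℝ :=
  ⨆ y : ℕ, |(ρ y).toReal - 1 / (n : ℝ) * ∑ i, if w i = y then 1 else 0|

theorem supDeviation_eq_freqDeviation {Ω : Type*} (Y : ℕ → Ω → ℕ) (ρ : PMF ℕ) (n : ℕ) (ω : Ω) :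
    supDeviation Y ρ n ω = freqDeviation ρ fun i : Fin n => Y i ω := by
  simp only [supDeviation, freqDeviation, empiricalFreq, Finset.sum_range]

section FreqDeviation

variable (ρ : PMF ℕ) {n : ℕ}

theorem abs_sub_freq_le_one (w : Fin n → ℕ) (y : ℕ) :
    |(ρ y).toReal - 1 / (n : ℝ) * ∑ i, if w i = y then 1 else 0| ≤ 1 := by
  have h1 : 0 ≤ (ρ y).toReal := ENNReal.toReal_nonneg
  have h2 := ρ.toReal_le_one y
  have h3 : 0 ≤ 1 / (n : ℝ) * ∑ i, (if w i = y then (1 : ℝ) else 0) := by positivity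
  have h4 : 1 / (n : ℝ) * ∑ i, (if w i = y then (1 : ℝ) else 0) ≤ 1 := by
    rw [one_div_mul_eq_div]
    refine div_le_one_of_le₀ ?_ (by positivity)
    refine (Finset.sum_le_sum (g := fun _ => 1) fun i _ => ?_).trans (by simp)
    split_ifs <;> simp
  exact abs_le.mpr ⟨by linarith, by linarith⟩

theorem abs_sub_freq_le_freqDeviation (w : Fin n → ℕ) (y : ℕ) :
    |(ρ y).toReal - 1 / (n : ℝ) * ∑ i, if w i = y then 1 else 0| ≤ freqDeviation ρ w :=
  le_ciSup (f := fun y : ℕ => |(ρ y).toReal - 1 / (n : ℝ) * ∑ i, if w i = y then 1 else 0|)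
    ⟨1, by rintro _ ⟨y, rfl⟩; exact abs_sub_freq_le_one ρ w y⟩ y

theorem freqDeviation_nonneg (w : Fin n → ℕ) : 0 ≤ freqDeviation ρ w :=
  (abs_nonneg _).trans (abs_sub_freq_le_freqDeviation ρ w 0)

theorem freqDeviation_le_one (w : Fin n → ℕ) : freqDeviation ρ w ≤ 1 :=
  ciSup_le fun y => abs_sub_freq_le_one ρ w y

theorem abs_freqDeviation_le_one (w : Fin n → ℕ) : |freqDeviation ρ w| ≤ 1 := by
  rw [abs_of_nonneg (freqDeviation_nonneg ρ w)]
  exact freqDeviation_le_one ρ w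

theorem hammingLipschitz_freqDeviation :
    HammingLipschitz (1 / (n : ℝ)) fun w : Fin n → ℕ => freqDeviation ρ w := by
  intro i w w' h
  refine ciSup_le fun y => ?_
  have h1 : |∑ j, (if w' j = y then (1 : ℝ) else 0) - ∑ j, (if w j = y then (1 : ℝ) else 0)|
      ≤ 1 := by
    rw [← Finset.sum_sub_distrib, Finset.sum_eq_single i (fun j _ hj => by rw [h j hj, sub_self])
      (by simp)]
    split_ifs <;> simp
  have h2 := abs_sub_freq_le_freqDeviation ρ w' y
  have h3 : |1 / (n : ℝ) * (∑ j, (if w' j = y then (1 : ℝ) else 0)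
      - ∑ j, (if w j = y then (1 : ℝ) else 0))| ≤ 1 / n := by
    rw [abs_mul, abs_of_nonneg (by positivity : (0 : ℝ) ≤ 1 / n)]
    exact mul_le_of_le_one_right (by positivity) h1
  refine le_trans ?_ (add_le_add h2 h3)
  refine le_trans (le_of_eq ?_) (abs_add_le _ _)
  congr 1
  ring

/-- The right-hand side is the squared `ℓ²` distance between `ρ` and the empirical distribution,
expanded; each squared coordinate is one term of that nonnegative series. -/
theorem freqDeviation_sq_le (w : Fin n → ℕ) :
    freqDeviation ρ w ^ 2 ≤ ∑' y, (ρ y).toReal ^ 2 - 2 / n * ∑ i, (ρ (w i)).toReal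
      + 1 / (n : ℝ) ^ 2 * coincidences w := by
  have hS : Summable fun y => (ρ y).toReal ^ 2 :=
    ρ.summable_toReal.of_nonneg_of_le (fun y => by positivity) fun y => by
      rw [sq]; exact mul_le_of_le_one_left ENNReal.toReal_nonneg (ρ.toReal_le_one y)
  have h1 : HasSum (fun y => ∑ i, if y = w i then (ρ (w i)).toReal else 0)
      (∑ i, (ρ (w i)).toReal) := hasSum_sum fun i _ => hasSum_ite_eq (w i) _
  have h2 : HasSum (fun y => ∑ i, ∑ j, if y = w i then (if w i = w j then (1 : ℝ) else 0) else 0)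
      (coincidences w) :=
    hasSum_sum fun i _ => hasSum_sum fun j _ => hasSum_ite_eq (w i) _
  have h3 := (hS.hasSum.sub (h1.mul_left (2 / n : ℝ))).add (h2.mul_left (1 / (n : ℝ) ^ 2))
  have key : ∀ y, ((ρ y).toReal - 1 / (n : ℝ) * ∑ i, if w i = y then 1 else 0) ^ 2 ≤
      ∑' y, (ρ y).toReal ^ 2 - 2 / n * ∑ i, (ρ (w i)).toReal
      + 1 / (n : ℝ) ^ 2 * coincidences w := by
    have e : ∀ y, ((ρ y).toReal ^ 2 - 2 / n * (∑ i, if y = w i then (ρ (w i)).toReal else 0))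
        + 1 / (n : ℝ) ^ 2 * (∑ i, ∑ j, if y = w i then (if w i = w j then (1 : ℝ) else 0) else 0)
        = ((ρ y).toReal - 1 / (n : ℝ) * ∑ i, if w i = y then 1 else 0) ^ 2 := fun y => by
      have e1 : (∑ i, if y = w i then (ρ (w i)).toReal else 0)
          = (ρ y).toReal * ∑ i, if w i = y then 1 else 0 := by
        rw [Finset.mul_sum]
        refine Finset.sum_congr rfl fun i _ => ?_
        by_cases h : y = w i
        · simp [← h]
        · simp [h, Ne.symm h]
      have e2 : (∑ i, ∑ j, if y = w i then (if w i = w j then (1 : ℝ) else 0) else 0)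
          = (∑ i, if w i = y then 1 else 0) * ∑ j, if w j = y then 1 else 0 := by
        rw [Finset.sum_mul_sum]
        refine Finset.sum_congr rfl fun i _ => Finset.sum_congr rfl fun j _ => ?_
        by_cases h : y = w i
        · simp [← h, eq_comm]
        · simp [h, Ne.symm h]
      rw [e1, e2]
      ring
    intro y
    rw [← e y]
    refine le_hasSum h3 y fun z _ => ?_
    rw [e z]
    positivity
  have hnn := (sq_nonneg _).trans (key 0)
  rw [← Real.sqrt_le_sqrt_iff hnn, Real.sqrt_sq (freqDeviation_nonneg ρ w)]
  exact ciSup_le fun y => Real.abs_le_sqrt (key y)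

end FreqDeviation

/-! ### Mean and tail of the deviation -/

theorem PMF.sq_integral_le {α : Type*} [MeasurableSpace α] [DiscreteMeasurableSpace α] (p : PMF α)
    {f : α → ℝ} {C : ℝ} (hf : ∀ a, |f a| ≤ C) :
    (∫ a, f a ∂p.toMeasure) ^ 2 ≤ ∫ a, f a ^ 2 ∂p.toMeasure := by
  set m := ∫ a, f a ∂p.toMeasure with hm
  have i1 := p.integrable_of_abs_le hf
  have i2 : Integrable (fun a => f a ^ 2) p.toMeasure :=
    p.integrable_of_abs_le (C := C ^ 2) fun a => by
      rw [abs_pow]; exact pow_le_pow_left₀ (abs_nonneg _) (hf a) 2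
  have h : 0 ≤ ∫ a, (f a - m) ^ 2 ∂p.toMeasure := integral_nonneg fun a => sq_nonneg _
  have e : ∫ a, (f a - m) ^ 2 ∂p.toMeasure = ∫ a, (f a ^ 2 - 2 * m * f a + m ^ 2) ∂p.toMeasure :=
    integral_congr_ae (Filter.Eventually.of_forall fun a => by dsimp only; ring)
  rw [e, integral_add (f := fun a => f a ^ 2 - 2 * m * f a) (i2.sub (i1.const_mul _))
    (integrable_const _), integral_sub i2 (i1.const_mul _), integral_const_mul, ← hm] at h
  simp only [integral_const, probReal_univ, one_smul] at h
  nlinarith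

theorem IsGeometricallyErgodic.integral_freqDeviation_le {π : PMF ℕ} {G θ : ℝ}
    (h : IsGeometricallyErgodic A π G θ) {n : ℕ} (hn : 1 ≤ n) :
    ∫ w : Fin n → ℕ, freqDeviation (π.bind B) w ∂(pathLaw A B n π).toMeasure ≤
      Real.sqrt ((1 + 2 * G * θ) / (n * (1 - θ))) := by
  set ρ := π.bind B with hρdef
  have hn0 : (0 : ℝ) < n := by exact_mod_cast hn
  have hθ : 0 < 1 - θ := sub_pos.mpr h.theta_lt_one
  have hρ : ∀ y, |(ρ y).toReal| ≤ 1 := fun y => by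
    rw [abs_of_nonneg ENNReal.toReal_nonneg]; exact ρ.toReal_le_one y
  refine Real.le_sqrt_of_sq_le ?_
  refine ((pathLaw A B n π).sq_integral_le (abs_freqDeviation_le_one ρ)).trans ?_
  have i0 : Integrable (fun _ => ∑' y, (ρ y).toReal ^ 2) (pathLaw A B n π).toMeasure :=
    integrable_const _
  have i1 : Integrable (fun w : Fin n → ℕ => ∑ i, (ρ (w i)).toReal) (pathLaw A B n π).toMeasure :=
    integrable_finsetSum _ fun i _ => PMF.integrable_of_abs_le _ fun w => hρ (w i)
  have i2 := (pathLaw A B n π).integrable_of_abs_le abs_coincidences_le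
  have i3 : Integrable (fun w : Fin n → ℕ => freqDeviation ρ w ^ 2) (pathLaw A B n π).toMeasure :=
    PMF.integrable_of_abs_le (C := 1) _ fun w => by
      rw [abs_pow]; exact pow_le_one₀ (abs_nonneg _) (abs_freqDeviation_le_one ρ w)
  have h1 := integral_mono i3 ((i0.sub (i1.const_mul (2 / n : ℝ))).add
    (i2.const_mul (1 / (n : ℝ) ^ 2))) fun w => freqDeviation_sq_le ρ w
  simp only [Pi.add_apply, Pi.sub_apply] at h1
  rw [integral_add (f := fun w : Fin n → ℕ => ∑' y, (ρ y).toReal ^ 2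
      - 2 / n * ∑ i, (ρ (w i)).toReal) (i0.sub (i1.const_mul (2 / n : ℝ)))
      (i2.const_mul (1 / (n : ℝ) ^ 2)), integral_sub i0 (i1.const_mul (2 / n : ℝ)),
    integral_const_mul, integral_const_mul,
    integral_pathLaw_sum_stationary (B := B) h.stationary n hρ] at h1
  have h2 := h.integral_coincidences_le (B := B) n
  rw [← hρdef] at h1 h2
  have hS : ∫ y, (ρ y).toReal ∂ρ.toMeasure = ∑' y, (ρ y).toReal ^ 2 := by
    rw [ρ.integral_eq_tsum _ (ρ.integrable_of_abs_le hρ)]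
    simp [sq]
  have hS0 : 0 ≤ ∑' y, (ρ y).toReal ^ 2 := tsum_nonneg fun y => by positivity
  rw [hS] at h1 h2
  set S := ∑' y, (ρ y).toReal ^ 2
  simp only [integral_const, probReal_univ, one_smul] at h1
  have h3 := mul_le_mul_of_nonneg_left h2 (by positivity : (0 : ℝ) ≤ 1 / (n : ℝ) ^ 2)
  refine h1.trans ((add_le_add le_rfl h3).trans ?_)
  -- The terms of order one in `S` cancel; only `-S / n` survives, because the diagonal pairs are
  -- not counted in `n * (n - 1)`. It is dropped below, and `1 - θ` in the numerator is relaxed to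
  -- `1`.
  have e : S - 2 / n * (n * S) + 1 / (n : ℝ) ^ 2 *
      (n * (1 + 2 * (G * θ / (1 - θ))) + n * (n - 1) * S) =
      (1 - θ + 2 * G * θ) / (n * (1 - θ)) - S / n := by
    field_simp
    ring
  rw [e]
  have h4 : (1 - θ + 2 * G * θ) / (n * (1 - θ)) ≤ (1 + 2 * G * θ) / (n * (1 - θ)) := by
    have := h.theta_nonneg
    gcongr
    linarith
  have h5 : 0 ≤ S / n := by positivity
  linarith

/-- Comparing both laws with `π` bounds the sum by `2Gθ/(1-θ)`; the leading `1` is absorbed in `2G`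
since `1 ≤ G`. -/
theorem IsGeometricallyErgodic.sum_tvDist_sub_le {π : PMF ℕ} {G θ : ℝ}
    (h : IsGeometricallyErgodic A π G θ) (k x x' : ℕ) :
    1 + ∑ s ∈ Finset.range k, tvDist (iterLaw A s (A x)) (iterLaw A s (A x')) ≤
      2 * G / (1 - θ) := by
  have hθ : 0 < 1 - θ := sub_pos.mpr h.theta_lt_one
  have h1 : ∑ s ∈ Finset.range k, tvDist (iterLaw A s (A x)) (iterLaw A s (A x')) ≤
      ∑ s ∈ Finset.range k, (tvDist (iterLaw A s (A x)) π + tvDist (iterLaw A s (A x')) π) :=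
    Finset.sum_le_sum fun s _ =>
      (tvDist_triangle _ π _).trans_eq (by rw [tvDist_comm π])
  rw [Finset.sum_add_distrib] at h1
  have h2 := h.sum_tvDist_le k x
  have h3 := h.sum_tvDist_le k x'
  have e : 2 * G / (1 - θ) = 2 * (G * θ / (1 - θ)) + 2 * G := by field_simp; ring
  rw [e]
  linarith [h.one_le_G]

theorem IsGeometricallyErgodic.measureReal_freqDeviation_le {π : PMF ℕ} {G θ : ℝ}
    (h : IsGeometricallyErgodic A π G θ) {n : ℕ} (hn : 1 ≤ n) {ε : ℝ} (hε : 0 < ε) :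
    (pathLaw A B n π).toMeasure.real {w | freqDeviation (π.bind B) w >
        Real.sqrt ((1 + 2 * G * θ) / (n * (1 - θ))) + ε} ≤
      Real.exp (-(n * (1 - θ) ^ 2 * ε ^ 2) / (2 * G ^ 2)) := by
  have hn0 : (0 : ℝ) < n := by exact_mod_cast hn
  have hθ : 0 < 1 - θ := sub_pos.mpr h.theta_lt_one
  have hG : 0 < G := zero_lt_one.trans_le h.one_le_G
  set ρ := π.bind B
  set P := (pathLaw A B n π).toMeasure
  set M := ∫ w, freqDeviation ρ w ∂P
  set D := 1 / (n : ℝ) * (2 * G / (1 - θ)) with hD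
  have hD0 : 0 < D := by positivity
  -- The minimiser of `-t * ε + n * t ^ 2 * D ^ 2 / 8`, with minimum `-2 * ε ^ 2 / (n * D ^ 2)`.
  set t := 4 * ε / (n * D ^ 2) with ht
  have ht0 : 0 ≤ t := by positivity
  have hint : Integrable (fun w => Real.exp (t * freqDeviation ρ w)) P :=
    PMF.integrable_of_abs_le (C := Real.exp t) _ fun w => by
      rw [Real.abs_exp, Real.exp_le_exp]
      exact mul_le_of_le_one_right ht0 (freqDeviation_le_one ρ w)
  have hmgf := integral_exp_pathLaw_le (A := A) (B := B) (hammingLipschitz_freqDeviation (n := n) ρ)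
    (abs_freqDeviation_le_one ρ) (fun k x x' => mul_le_mul_of_nonneg_left
      (h.sum_tvDist_sub_le k x x') (by positivity : (0 : ℝ) ≤ 1 / n)) π t
  have hM : M ≤ Real.sqrt ((1 + 2 * G * θ) / (n * (1 - θ))) := h.integral_freqDeviation_le hn
  calc P.real {w | freqDeviation ρ w > Real.sqrt ((1 + 2 * G * θ) / (n * (1 - θ))) + ε}
      ≤ P.real {w | M + ε ≤ freqDeviation ρ w} := measureReal_mono fun w hw => by
        simp only [Set.mem_ofPred_eq] at hw ⊢
        linarith
    _ ≤ Real.exp (-t * (M + ε)) * ProbabilityTheory.mgf (fun w => freqDeviation ρ w) P t :=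
        ProbabilityTheory.measure_ge_le_exp_mul_mgf _ ht0 hint
    _ ≤ Real.exp (-t * (M + ε)) * Real.exp (t * M + n * (t ^ 2 * D ^ 2 / 8)) :=
        mul_le_mul_of_nonneg_left hmgf (Real.exp_nonneg _)
    _ = Real.exp (-(n * (1 - θ) ^ 2 * ε ^ 2) / (2 * G ^ 2)) := by
        rw [← Real.exp_add]
        congr 1
        rw [ht, hD]
        field_simp
        ring

end HiddenMarkov

theorem theorem2 {Ω : Type*} [MeasurableSpace Ω] (μ : Measure Ω) [IsProbabilityMeasure μ]
    (Y : ℕ → Ω → ℕ) (A : ℕ → PMF ℕ) (π ρ : PMF ℕ) (G θ : ℝ)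
    (hA : IsGeometricallyErgodic A π G θ)
    (hY : (IsMarkovChain μ Y π A ∧ ρ = π) ∨
      ∃ B : ℕ → PMF ℕ, IsHiddenMarkovChain μ Y π A B ∧ ρ = π.bind B)
    (n : ℕ) (hn : 1 ≤ n) (ε : ℝ) (hε : 0 < ε) :
    μ.real {ω | supDeviation Y ρ n ω > Real.sqrt ((1 + 2 * G * θ) / (n * (1 - θ))) + ε} ≤
      Real.exp (-(n * (1 - θ) ^ 2 * ε ^ 2) / (2 * G ^ 2)) := by
  obtain ⟨B, hB, rfl⟩ : ∃ B : ℕ → PMF ℕ, IsHiddenMarkovChain μ Y π A B ∧ ρ = π.bind B := by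
    rcases hY with ⟨h, rfl⟩ | h
    · exact ⟨PMF.pure, h.isHiddenMarkovChain, ρ.bind_pure.symm⟩
    · exact h
  refine le_trans (le_of_eq ?_) (hA.measureReal_freqDeviation_le (B := B) hn hε)
  -- Laws of the chain are specified on words of length `m + 1`, so `n` has to be a successor.
  obtain ⟨m, rfl⟩ := Nat.exists_eq_succ_of_ne_zero (Nat.one_le_iff_ne_zero.mp hn)
  have hm : Measurable fun ω (i : Fin (m + 1)) => Y i ω := measurable_pi_lambda _ fun i => hB.1 i
  rw [← hB.map_eq m, map_measureReal_apply hm (Set.to_countable _).measurableSet]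
  simp only [supDeviation_eq_freqDeviation]
  rfl
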